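/- Let $\{v_0,v_1\}$ be the standard basis of $\mathbb{C}^2$ with dual basis $\{v_0^*,v_1^*\}$. For $I\subseteq[n]$ let $\langle I|=v_{\chi_I(1)}^*\otimes\cdots\otimes v_{\chi_I(n)}^*\in((\mathbb{C}^2)^*)^{\otimes n}$, where $\chi_I$ is the characteristic function of $I$. Let $W_n\subseteq((\mathbb{C}^2)^*)^{\otimes n}$ be the span of the $\langle I|$ with $|I|$ even, and let $P_{W_n}$ be the linear projector onto $W_n$ that sends $\langle I|$ to $0$ for $|I|$ odd. For a complex skew-symmetric $n\times n$ matrix $M$ put $\operatorname{sPf}^\vee(M)=\sum_{I\subseteq[n]}\operatorname{Pf}(M_I)\,\langle [n]\setminus I|$, where $M_I$ is the principal submatrix with rows and columns in $I$ and $\operatorname{Pf}(M_\emptyset)=1$. Let $\mathcal{P}_n^\vee$ be the set of all the tensors $\operatorname{sPf}^\vee(M)$ (the elementary Pfaffian cogates of arity $n$), let $\mathbb{C}^*\mathcal{P}_n^\vee=\{cP : c\in\mathbb{C}\setminus\{0\},\ P\in\mathcal{P}_n^\vee\}$, and let the cone $\mathbb{C}\mathcal{P}_n^\vee$ be the Zariski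 closure of $\{cP : c\in\mathbb{C},\ P\in\mathcal{P}_n^\vee\}$. The groups $\operatorname{SL}(2,\mathbb{C})^n\subseteq\operatorname{GL}(2,\mathbb{C})^n$ act on $((\mathbb{C}^2)^*)^{\otimes n}$ factor by factor through $g.\varphi=\varphi\circ g^{-1}$. Let $$\mathrm{SWAP}=\langle 0000|+\langle 1010|+\langle 0101|+\langle 1111|\in((\mathbb{C}^2)^*)^{\otimes 4}.$$ Then for every $k\ge 2$ and $G=\mathrm{SWAP}^{\otimes k}\in((\mathbb{C}^2)^*)^{\otimes 4k}$, the following holds, where the bar denotes the Zariski closure: $$P_{W_{4k}}\bigl(\overline{\operatorname{SL}(2,\mathbb{C})^{4k}.G}\bigr)\cap\bigl(\mathbb{C}\mathcal{P}^\vee_{4k}\setminus\{0\}\bigr)=\emptyset \qquad\text{and}\qquad P_{W_{4k}}\bigl(\operatorname{GL}(2,\mathbb{C})^{4k}.G\bigr)\cap\mathbb{C}^*\mathcal{P}^\vee_{4k}=\emptyset .$$ -/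

import Mathlib

open scoped TensorProduct

namespace PfaffianCogates

noncomputable section

/-- The space `((ℂ²)^*)^{⊗ n}` of covector tensors. -/
abbrev Cotensor (n : ℕ) : Type := ⨂[ℂ]^n (Module.Dual ℂ (Fin 2 → ℂ))

/-- The basis `⟨0|, ⟨1|` of `(ℂ²)^*` dual to the standard basis of `ℂ²`. -/
def dualStdBasis : Module.Basis (Fin 2) ℂ (Module.Dual ℂ (Fin 2 → ℂ)) :=
  (Pi.basisFun ℂ (Fin 2)).dualBasis

/-- The covector `⟨x₁ ⋯ xₙ| = ⟨x₁| ⊗ ⋯ ⊗ ⟨xₙ|`. -/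
def bra {n : ℕ} (x : Fin n → Fin 2) : Cotensor n :=
  PiTensorProduct.tprod ℂ fun i => dualStdBasis (x i)

/-- The basis of `((ℂ²)^*)^{⊗ n}` formed by the covectors `⟨x₁ ⋯ xₙ|`. -/
def braBasis (n : ℕ) : Module.Basis (Fin n → Fin 2) ℂ (Cotensor n) :=
  Basis.piTensorProduct fun _ => dualStdBasis

theorem braBasis_apply {n : ℕ} (x : Fin n → Fin 2) : braBasis n x = bra x := by
  simp [braBasis, bra]

/-- The characteristic vector `χ_I` of `I ⊆ [n]`; the covector `⟨I|` is `bra (chi I)`. -/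
def chi {n : ℕ} (I : Finset (Fin n)) : Fin n → Fin 2 := fun i => if i ∈ I then 1 else 0

/-- The linear projector onto the subspace `Wₙ` of tensors of even support: it fixes `⟨x|`
if `x` has an even number of ones and kills it otherwise. -/
def evenProj (n : ℕ) : Cotensor n →ₗ[ℂ] Cotensor n :=
  (braBasis n).constr ℂ fun x =>
    if Even (Finset.univ.filter fun i => x i = 1).card then bra x else 0

/-- The Pfaffian `Pf(M_I)` of the principal submatrix of a (skew-symmetric) matrix `M` with rows
and columns in `I`, by expansion along the first row `i = min I`; `Pf(M_∅) = 1`.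
If `j` is the `r`-th smallest element of `I`, then the term of `j` has the sign `(-1)^r`, where
`r - 1` is the number of elements of `I` below `j`. It is `0` if `I` has odd cardinality. -/
def pfaffian {n : ℕ} (M : Matrix (Fin n) (Fin n) ℂ) (I : Finset (Fin n)) : ℂ :=
  if h : I.Nonempty then
    ∑ j ∈ I.erase (I.min' h),
      (-1) ^ ((I.filter fun l => l < j).card + 1) * M (I.min' h) j *
        pfaffian M ((I.erase (I.min' h)).erase j)
  else 1
termination_by I.card
decreasing_by
  exact lt_of_le_of_lt (Finset.card_le_card (Finset.erase_subset _ _))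
    (Finset.card_erase_lt_of_mem (I.min'_mem h))

/-- `sPf^∨(M) = ∑_I Pf(M_I) ⟨Iᶜ|`. -/
def subPfaffianDual {n : ℕ} (M : Matrix (Fin n) (Fin n) ℂ) : Cotensor n :=
  ∑ I : Finset (Fin n), pfaffian M I • bra (chi Iᶜ)

/-- The set `𝒫ₙ^∨` of elementary Pfaffian cogates of arity `n`. -/
def cogates (n : ℕ) : Set (Cotensor n) :=
  {T | ∃ M : Matrix (Fin n) (Fin n) ℂ, M.transpose = -M ∧ T = subPfaffianDual M}

/-- The Zariski closure of a set of tensors, with respect to the coordinates of `braBasis`. -/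
def zariskiClosure {n : ℕ} (X : Set (Cotensor n)) : Set (Cotensor n) :=
  (fun T => ⇑((braBasis n).repr T)) ⁻¹'
    MvPolynomial.zeroLocus ℂ
      (MvPolynomial.vanishingIdeal ℂ ((fun T => ⇑((braBasis n).repr T)) '' X))

/-- `ℂ^* 𝒫ₙ^∨`, the nonzero multiples of elementary cogates. -/
def cogateMultiples (n : ℕ) : Set (Cotensor n) :=
  {T | ∃ c : ℂ, c ≠ 0 ∧ ∃ P ∈ cogates n, T = c • P}

/-- The (closed) cone `ℂ 𝒫ₙ^∨` over the variety of elementary cogates: the Zariski closure of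
the set of scalar multiples of elementary cogates. -/
def cogateCone (n : ℕ) : Set (Cotensor n) :=
  zariskiClosure {T | ∃ c : ℂ, ∃ P ∈ cogates n, T = c • P}

/-- The action of `GL(2,ℂ)^n` on `((ℂ²)^*)^{⊗ n}` induced by `g.φ = φ ∘ g⁻¹` on each factor. -/
def act {n : ℕ} (g : Fin n → GL (Fin 2) ℂ) : Cotensor n →ₗ[ℂ] Cotensor n :=
  PiTensorProduct.map fun j => (Matrix.toLin' ((g j)⁻¹ : GL (Fin 2) ℂ).val).dualMap

/-- The orbit `GL(2,ℂ)^n . T`. -/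
def orbitGL {n : ℕ} (T : Cotensor n) : Set (Cotensor n) :=
  Set.range fun g : Fin n → GL (Fin 2) ℂ => act g T

/-- The orbit `SL(2,ℂ)^n . T`. -/
def orbitSL {n : ℕ} (T : Cotensor n) : Set (Cotensor n) :=
  Set.range fun g : Fin n → Matrix.SpecialLinearGroup (Fin 2) ℂ =>
    act (fun j => (g j : GL (Fin 2) ℂ)) T

/-- The SWAP tensor `⟨0000| + ⟨1010| + ⟨0101| + ⟨1111|`. -/
def swap : Cotensor 4 :=
  bra ![0, 0, 0, 0] + bra ![1, 0, 1, 0] + bra ![0, 1, 0, 1] + bra ![1, 1, 1, 1]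

/-- The tensor power `SWAP^{⊗ k}`, in `((ℂ²)^*)^{⊗ 4k}`. -/
def swapPow : (k : ℕ) → Cotensor (4 * k)
  | 0 => PiTensorProduct.tprod ℂ Fin.elim0
  | k + 1 => TensorPower.mulEquiv (n := 4 * k) (m := 4) (swapPow k ⊗ₜ[ℂ] swap)

end

end PfaffianCogates

/-! The coordinates of a cogate are sub-Pfaffians, so they satisfy the four-term Grassmann–Plücker
relations. These are quadrics, hence they persist on the closed cone. They come from fermionic
operators: the vector of sub-Pfaffians is killed by `dressed M i`, and skew-symmetry of `M` turns
this into the bilinear identity `pfaffian_bilinear`.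

On the other side, SWAP pairs sites 0, 2 and sites 1, 3 of each block. A tensor in the GL-orbit is
therefore a product of invertible 2×2 matrices, one per edge of this pairing. So is a tensor in the
closure of the SL-orbit, up to a scalar, because Segre quadrics and a quadratic invariant built from
determinants survive the closure.

The two edges of a block cross, and this conflicts with the quadrics. Take both ends of an edge `e`,
the end of the crossing edge lying between them, and a site of a later block. There the quadric is
`± 2 det (A e)` times mixed products of entries, so one of any two blocks is monomial
(`isMonomialBlock_or`). In a monomial block the quadric at its own four sites has a surviving term
(`not_isMonomialBlock`). Two blocks thus force the even part to vanish. -/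

namespace PfaffianCogates

/-! ### Fermionic operators and the quadratic relations between sub-Pfaffians -/

section Fock

variable {n : ℕ}

/-- The sign `(-1)^{#{l ∈ J : l < i}}`. -/
def fockSign (i : Fin n) (J : Finset (Fin n)) : ℂ := (-1) ^ (J.filter fun l => l < i).card

theorem fockSign_mul_self (i : Fin n) (J : Finset (Fin n)) :
    fockSign i J * fockSign i J = 1 := by
  rw [fockSign, ← mul_pow]; norm_num

theorem fockSign_insert {i j : Fin n} {J : Finset (Fin n)} (hj : j ∉ J) :
    fockSign i (insert j J) = (if j < i then -1 else 1) * fockSign i J := by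
  unfold fockSign
  rw [Finset.filter_insert]
  split_ifs with h
  · rw [Finset.card_insert_of_notMem (by simp [hj]), pow_succ]; ring
  · ring

theorem fockSign_erase {i j : Fin n} {J : Finset (Fin n)} (hj : j ∈ J) :
    fockSign i (J.erase j) = (if j < i then -1 else 1) * fockSign i J := by
  conv_rhs => rw [← Finset.insert_erase hj, fockSign_insert (Finset.notMem_erase j J)]
  split_ifs <;> ring

/-- The annihilation operator of the `i`-th fermionic mode. -/
def annihilate (i : Fin n) : Module.End ℂ (Finset (Fin n) → ℂ) where
  toFun c J := if i ∈ J then 0 else fockSign i J * c (insert i J)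
  map_add' c d := by ext J; by_cases h : i ∈ J <;> simp [h, mul_add]
  map_smul' a c := by ext J; by_cases h : i ∈ J <;> simp [h, mul_left_comm]

/-- The creation operator of the `i`-th fermionic mode. -/
def create (i : Fin n) : Module.End ℂ (Finset (Fin n) → ℂ) where
  toFun c J := if i ∈ J then fockSign i J * c (J.erase i) else 0
  map_add' c d := by ext J; by_cases h : i ∈ J <;> simp [h, mul_add]
  map_smul' a c := by ext J; by_cases h : i ∈ J <;> simp [h, mul_left_comm]

theorem annihilate_apply (i : Fin n) (c : Finset (Fin n) → ℂ) (J : Finset (Fin n)) :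
    annihilate i c J = if i ∈ J then 0 else fockSign i J * c (insert i J) := rfl

theorem create_apply (i : Fin n) (c : Finset (Fin n) → ℂ) (J : Finset (Fin n)) :
    create i c J = if i ∈ J then fockSign i J * c (J.erase i) else 0 := rfl

theorem annihilate_anticomm (i j : Fin n) :
    annihilate i * annihilate j + annihilate j * annihilate i = 0 := by
  refine LinearMap.ext fun c => funext fun J => ?_
  simp only [LinearMap.add_apply, Module.End.mul_apply, Pi.add_apply, annihilate_apply,
    LinearMap.zero_apply, Pi.zero_apply]
  rcases lt_trichotomy i j with h | rfl | h
  · by_cases hi : i ∈ J <;> by_cases hj : j ∈ J <;>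
      simp [hi, hj, h.ne, h.ne', fockSign_insert, h, h.not_gt, Finset.insert_comm j i]
    ring
  · simp
  · by_cases hi : i ∈ J <;> by_cases hj : j ∈ J <;>
      simp [hi, hj, h.ne, h.ne', fockSign_insert, h, h.not_gt, Finset.insert_comm j i]
    ring

theorem create_anticomm (i j : Fin n) :
    create i * create j + create j * create i = 0 := by
  refine LinearMap.ext fun c => funext fun J => ?_
  simp only [LinearMap.add_apply, Module.End.mul_apply, Pi.add_apply, create_apply,
    LinearMap.zero_apply, Pi.zero_apply]
  rcases lt_trichotomy i j with h | rfl | h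
  · by_cases hi : i ∈ J <;> by_cases hj : j ∈ J <;>
      simp [hi, hj, h.ne, h.ne', fockSign_erase, h, h.not_gt, Finset.erase_right_comm (a := j) (b := i)]
    ring
  · simp
  · by_cases hi : i ∈ J <;> by_cases hj : j ∈ J <;>
      simp [hi, hj, h.ne, h.ne', fockSign_erase, h, h.not_gt, Finset.erase_right_comm (a := j) (b := i)]
    ring

theorem annihilate_create_anticomm (i j : Fin n) :
    annihilate i * create j + create j * annihilate i = if i = j then 1 else 0 := by
  refine LinearMap.ext fun c => funext fun J => ?_
  simp only [LinearMap.add_apply, Module.End.mul_apply, Pi.add_apply, create_apply,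
    annihilate_apply]
  rcases eq_or_ne i j with rfl | h
  · by_cases hi : i ∈ J
    · simp [hi, fockSign_erase, ← mul_assoc, fockSign_mul_self]
    · simp [hi, fockSign_insert, ← mul_assoc, fockSign_mul_self]
  · by_cases hi : i ∈ J <;> by_cases hj : j ∈ J <;>
      simp [hi, hj, h, h.symm, fockSign_erase, fockSign_insert, Finset.erase_insert_of_ne h]
    rcases lt_or_gt_of_ne h with h' | h' <;> simp [h', h'.not_gt] <;> ring

/-- The operator `∂ᵢ - ∑ⱼ Mᵢⱼ eⱼ`, which kills the vector of sub-Pfaffians of `M`. -/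
def dressed (M : Matrix (Fin n) (Fin n) ℂ) (i : Fin n) : Module.End ℂ (Finset (Fin n) → ℂ) :=
  annihilate i - ∑ j, M i j • create j

/-- The canonical anticommutation relations reduce the anticommutator to the scalar `-(M k i + M i
k)`, which is zero by skew-symmetry. -/
theorem dressed_anticomm {M : Matrix (Fin n) (Fin n) ℂ} (hM : M.transpose = -M) (i k : Fin n) :
    dressed M i * dressed M k + dressed M k * dressed M i = 0 := by
  have h1 : ∀ i k : Fin n, annihilate i * (∑ j, M k j • create j) +
      (∑ j, M k j • create j) * annihilate i = algebraMap ℂ _ (M k i) := by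
    intro i k
    rw [Finset.mul_sum, Finset.sum_mul, ← Finset.sum_add_distrib]
    simp_rw [mul_smul_comm, smul_mul_assoc, ← smul_add, annihilate_create_anticomm]
    simp [Algebra.algebraMap_eq_smul_one]
  have h2 : (∑ j, M i j • create j) * (∑ j, M k j • create j) +
      (∑ j, M k j • create j) * (∑ j, M i j • create j) = 0 := by
    rw [Finset.sum_mul_sum, Finset.sum_mul_sum, Finset.sum_comm, ← Finset.sum_add_distrib]
    refine Finset.sum_eq_zero fun a _ => ?_
    rw [← Finset.sum_add_distrib]
    refine Finset.sum_eq_zero fun b _ => ?_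
    rw [smul_mul_smul_comm, smul_mul_smul_comm, mul_comm (M k a), ← smul_add, create_anticomm,
      smul_zero]
  have h3 : M k i + M i k = 0 := by
    have := congrFun (congrFun hM i) k
    simp only [Matrix.transpose_apply, Matrix.neg_apply] at this
    rw [this]; ring
  have h4 := annihilate_anticomm i k
  have h5 := h1 i k
  have h6 := h1 k i
  unfold dressed
  generalize (∑ j, M i j • create j) = a at *
  generalize (∑ j, M k j • create j) = b at *
  have : (annihilate i - a) * (annihilate k - b) + (annihilate k - b) * (annihilate i - a) =
      (annihilate i * annihilate k + annihilate k * annihilate i) -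
      (annihilate i * b + b * annihilate i) - (annihilate k * a + a * annihilate k) +
      (a * b + b * a) := by
    simp only [sub_mul, mul_sub]; abel
  rw [this, h2, h4, h5, h6, zero_sub, add_zero, ← neg_add', ← map_add, h3, map_zero, neg_zero]

theorem dressed_apply (M : Matrix (Fin n) (Fin n) ℂ) (i : Fin n) (c : Finset (Fin n) → ℂ)
    (J : Finset (Fin n)) :
    dressed M i c J = annihilate i c J - ∑ j, M i j * create j c J := by
  simp [dressed, LinearMap.sum_apply, Finset.sum_apply]

/-- A vector which is killed by the dressed operators in the smallest index is killed by them. -/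
theorem dressed_eq_zero_of_min {M : Matrix (Fin n) (Fin n) ℂ} (hM : M.transpose = -M)
    {c : Finset (Fin n) → ℂ}
    (hc : ∀ (i : Fin n) (J : Finset (Fin n)), (∀ j ∈ J, i < j) → dressed M i c J = 0)
    (J : Finset (Fin n)) : ∀ i, dressed M i c J = 0 := by
  induction J using Finset.strongInduction with
  | H J ih =>
  intro i
  rcases J.eq_empty_or_nonempty with rfl | hJ
  · exact hc i ∅ (by simp)
  set m := J.min' hJ with hm
  have hmJ : m ∈ J := J.min'_mem hJ
  have hlt : ∀ j ∈ J.erase m, m < j := fun j hj =>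
    lt_of_le_of_ne (J.min'_le j (Finset.mem_of_mem_erase hj)) (Finset.ne_of_mem_erase hj).symm
  have hcre : ∀ a b, (∑ j, M a j * create j (dressed M b c) (J.erase m)) = 0 := by
    intro a b
    refine Finset.sum_eq_zero fun j _ => ?_
    rw [create_apply]
    split_ifs
    · rw [ih _ (lt_of_le_of_lt (Finset.erase_subset j _) (Finset.erase_ssubset hmJ))]; simp
    · simp
  -- At `J.erase m` the creation part of `dressed M m` only sees proper subsets of `J`, where
  -- induction applies. The annihilation part returns the value at `J` up to sign.
  have key : dressed M m (dressed M i c) (J.erase m) = 0 → dressed M i c J = 0 := by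
    intro h
    rw [dressed_apply, hcre, annihilate_apply, if_neg (Finset.notMem_erase m J),
      Finset.insert_erase hmJ, sub_zero] at h
    have := fockSign_mul_self m (J.erase m)
    rcases mul_eq_zero.1 h with h | h
    · simp [h] at this
    · exact h
  have hanti := congrFun (LinearMap.congr_fun (dressed_anticomm hM m i) c) (J.erase m)
  simp only [LinearMap.add_apply, Module.End.mul_apply, Pi.add_apply, LinearMap.zero_apply,
    Pi.zero_apply] at hanti
  -- For `i = m` the anticommutator is twice the square. For `m < i` the order is exchanged, so that
  -- `dressed M m c` is only evaluated on sets lying above `m`.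
  rcases lt_trichotomy i m with h | h | h
  · exact hc i J fun j hj => lt_of_lt_of_le h (J.min'_le j hj)
  · apply key
    rw [h] at hanti ⊢
    exact add_self_eq_zero.1 hanti
  · apply key
    suffices dressed M i (dressed M m c) (J.erase m) = 0 by rwa [this, add_zero] at hanti
    rw [dressed_apply, hcre, annihilate_apply]
    split_ifs
    · simp
    · rw [hc m _ fun j hj => ?_]
      · simp
      · rcases Finset.mem_insert.1 hj with rfl | hj
        exacts [h, hlt j hj]

/-- Expansion along the smallest index is exactly the case where `i` lies below `J`; anticommutation
propagates it to all `J`. -/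
theorem dressed_pfaffian {M : Matrix (Fin n) (Fin n) ℂ} (hM : M.transpose = -M) (i : Fin n) :
    dressed M i (pfaffian M) = 0 := by
  ext J
  refine dressed_eq_zero_of_min hM (fun i J hJ => ?_) J i
  have hi : i ∉ J := fun h => lt_irrefl i (hJ i h)
  have hne : (insert i J).Nonempty := Finset.insert_nonempty i J
  have hmin : (insert i J).min' hne = i := by
    refine le_antisymm (Finset.min'_le _ _ (Finset.mem_insert_self i J)) ?_
    refine Finset.le_min' _ _ _ fun j hj => ?_
    rcases Finset.mem_insert.1 hj with rfl | hj
    exacts [le_rfl, (hJ j hj).le]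
  have hs : fockSign i J = 1 := by
    rw [fockSign, Finset.filter_false_of_mem fun j hj => (hJ j hj).not_gt]; simp
  rw [dressed_apply, annihilate_apply, if_neg hi, hs, one_mul, pfaffian, dif_pos hne, hmin,
    Finset.erase_insert hi, sub_eq_zero, ← Finset.sum_subset (Finset.subset_univ J)]
  · refine Finset.sum_congr rfl fun j hj => ?_
    rw [create_apply, if_pos hj, fockSign, Finset.filter_insert, if_pos (hJ j hj),
      Finset.card_insert_of_notMem (by simp [hi])]
    ring
  · intro j _ hj
    simp [create_apply, hj]

/-- Replacing each annihilation by `∑ j, M i j • create j` leaves a double sum in which `M i j` and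
`M j i` multiply the same product and cancel. -/
theorem pfaffian_bilinear {M : Matrix (Fin n) (Fin n) ℂ} (hM : M.transpose = -M)
    (X Y : Finset (Fin n)) :
    ∑ i, (create i (pfaffian M) X * annihilate i (pfaffian M) Y +
      annihilate i (pfaffian M) X * create i (pfaffian M) Y) = 0 := by
  have h : ∀ i J, annihilate i (pfaffian M) J = ∑ j, M i j * create j (pfaffian M) J := by
    intro i J
    have := congrFun (dressed_pfaffian hM i) J
    rwa [dressed_apply, Pi.zero_apply, sub_eq_zero] at this
  have hs : ∀ i j, M j i = -M i j := fun i j => congrFun (congrFun hM i) j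
  simp_rw [h, Finset.mul_sum, Finset.sum_mul, Finset.sum_add_distrib]
  conv_lhs => rw [Finset.sum_comm]
  rw [← Finset.sum_add_distrib]
  refine Finset.sum_eq_zero fun a _ => ?_
  rw [← Finset.sum_add_distrib]
  refine Finset.sum_eq_zero fun b _ => ?_
  rw [hs a b]
  ring

/-- This is the bilinear identity at `R ∪ {p}` and `R ∪ {q, r, s}`: only indices in exactly one of
the two sets contribute, and the signs coming from `R` occur squared. -/
theorem pfaffian_four_term_even {M : Matrix (Fin n) (Fin n) ℂ} (hM : M.transpose = -M)
    {R : Finset (Fin n)} {p q r s : Fin n} (hpq : p < q) (hqr : q < r) (hrs : r < s)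
    (hp : p ∉ R) (hq : q ∉ R) (hr : r ∉ R) (hs : s ∉ R) :
    pfaffian M R * pfaffian M (insert p (insert q (insert r (insert s R)))) -
      pfaffian M (insert p (insert q R)) * pfaffian M (insert r (insert s R)) +
      pfaffian M (insert p (insert r R)) * pfaffian M (insert q (insert s R)) -
      pfaffian M (insert p (insert s R)) * pfaffian M (insert q (insert r R)) = 0 := by
  have H := pfaffian_bilinear hM (insert p R) (insert q (insert r (insert s R)))
  have hpr := hpq.trans hqr
  have hqs := hqr.trans hrs
  have hps := hpr.trans hrs
  rw [← Finset.sum_subset (Finset.subset_univ ({p, q, r, s} : Finset (Fin n)))] at H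
  · rw [Finset.sum_insert (by simp [hpq.ne, hpr.ne, hps.ne]),
      Finset.sum_insert (by simp [hqr.ne, hqs.ne]),
      Finset.sum_insert (by simp [hrs.ne]), Finset.sum_singleton] at H
    have e1 := fockSign_mul_self p R
    have e2 := fockSign_mul_self q R
    have e3 := fockSign_mul_self r R
    have e4 := fockSign_mul_self s R
    simp [create_apply, annihilate_apply, fockSign_insert, hp, hq, hr, hs, hpq.ne, hpq.ne', hpr.ne,
      hpr.ne', hps.ne, hps.ne', hqr.ne, hqr.ne', hqs.ne, hqs.ne', hrs.ne, hrs.ne', hpq, hpr, hps,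
      hqr, hqs, hrs, hpq.not_gt, hpr.not_gt, hps.not_gt, hqr.not_gt, hqs.not_gt, hrs.not_gt,
      Finset.erase_insert_of_ne] at H
    rw [Finset.insert_comm q p, Finset.insert_comm r p R, Finset.insert_comm s p R] at H
    linear_combination H
      - pfaffian M R * pfaffian M (insert p (insert q (insert r (insert s R)))) * e1
      + pfaffian M (insert p (insert q R)) * pfaffian M (insert r (insert s R)) * e2
      - pfaffian M (insert p (insert r R)) * pfaffian M (insert q (insert s R)) * e3
      + pfaffian M (insert p (insert s R)) * pfaffian M (insert q (insert r R)) * e4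
  · intro i _ hi
    simp only [Finset.mem_insert, Finset.mem_singleton, not_or] at hi
    by_cases h : i ∈ R <;> simp [create_apply, annihilate_apply, hi, h]

/-- The same identity at `R` and `R ∪ {p, q, r, s}`. -/
theorem pfaffian_four_term_odd {M : Matrix (Fin n) (Fin n) ℂ} (hM : M.transpose = -M)
    {R : Finset (Fin n)} {p q r s : Fin n} (hpq : p < q) (hqr : q < r) (hrs : r < s)
    (hp : p ∉ R) (hq : q ∉ R) (hr : r ∉ R) (hs : s ∉ R) :
    pfaffian M (insert p R) * pfaffian M (insert q (insert r (insert s R))) -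
      pfaffian M (insert q R) * pfaffian M (insert p (insert r (insert s R))) +
      pfaffian M (insert r R) * pfaffian M (insert p (insert q (insert s R))) -
      pfaffian M (insert s R) * pfaffian M (insert p (insert q (insert r R))) = 0 := by
  have H := pfaffian_bilinear hM R (insert p (insert q (insert r (insert s R))))
  have hpr := hpq.trans hqr
  have hqs := hqr.trans hrs
  have hps := hpr.trans hrs
  rw [← Finset.sum_subset (Finset.subset_univ ({p, q, r, s} : Finset (Fin n)))] at H
  · rw [Finset.sum_insert (by simp [hpq.ne, hpr.ne, hps.ne]),
      Finset.sum_insert (by simp [hqr.ne, hqs.ne]),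
      Finset.sum_insert (by simp [hrs.ne]), Finset.sum_singleton] at H
    have e1 := fockSign_mul_self p R
    have e2 := fockSign_mul_self q R
    have e3 := fockSign_mul_self r R
    have e4 := fockSign_mul_self s R
    simp [create_apply, annihilate_apply, fockSign_insert, hp, hq, hr, hs, hpq.ne, hpq.ne', hpr.ne,
      hpr.ne', hps.ne, hps.ne', hqr.ne, hqr.ne', hqs.ne, hqs.ne', hrs.ne, hrs.ne', hpq, hpr, hps,
      hqr, hqs, hrs, hpq.not_gt, hpr.not_gt, hps.not_gt, hqr.not_gt, hqs.not_gt, hrs.not_gt,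
      Finset.erase_insert_of_ne] at H
    linear_combination H
      - pfaffian M (insert p R) * pfaffian M (insert q (insert r (insert s R))) * e1
      + pfaffian M (insert q R) * pfaffian M (insert p (insert r (insert s R))) * e2
      - pfaffian M (insert r R) * pfaffian M (insert p (insert q (insert s R))) * e3
      + pfaffian M (insert s R) * pfaffian M (insert p (insert q (insert r R))) * e4
  · intro i _ hi
    simp only [Finset.mem_insert, Finset.mem_singleton, not_or] at hi
    by_cases h : i ∈ R <;> simp [create_apply, annihilate_apply, hi, h]

end Fock

/-! ### Four-term relations for functions of binary words -/

section FourTerm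

variable {n : ℕ}

/-- The word `x` with the letters at the positions `p, q, r, s` replaced by `a, b, c, d`. -/
def update₄ (x : Fin n → Fin 2) (p q r s : Fin n) (a b c d : Fin 2) : Fin n → Fin 2 :=
  Function.update (Function.update (Function.update (Function.update x p a) q b) r c) s d

theorem update₄_apply (x : Fin n → Fin 2) (p q r s : Fin n) (a b c d : Fin 2) (l : Fin n) :
    update₄ x p q r s a b c d l =
      if l = s then d else if l = r then c else if l = q then b else if l = p then a else x l := by
  simp only [update₄, Function.update_apply]

/-- The even four-term quadric on a function of four bits. -/
def evenQuadric (w : Fin 2 → Fin 2 → Fin 2 → Fin 2 → ℂ) : ℂ :=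
  w 0 0 0 0 * w 1 1 1 1 - w 1 1 0 0 * w 0 0 1 1 + w 1 0 1 0 * w 0 1 0 1 - w 1 0 0 1 * w 0 1 1 0

/-- The odd four-term quadric on a function of four bits. -/
def oddQuadric (w : Fin 2 → Fin 2 → Fin 2 → Fin 2 → ℂ) : ℂ :=
  w 1 0 0 0 * w 0 1 1 1 - w 0 1 0 0 * w 1 0 1 1 + w 0 0 1 0 * w 1 1 0 1 - w 0 0 0 1 * w 1 1 1 0

/-- The four-term Grassmann–Plücker relations for the coordinates of a Pfaffian cogate. -/
def FourTermRelations (t : (Fin n → Fin 2) → ℂ) : Prop :=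
  ∀ (x : Fin n → Fin 2) (p q r s : Fin n), p < q → q < r → r < s →
    evenQuadric (fun a b c d => t (update₄ x p q r s a b c d)) = 0 ∧
      oddQuadric (fun a b c d => t (update₄ x p q r s a b c d)) = 0

theorem zeros_update₄ (x : Fin n → Fin 2) {p q r s : Fin n} (hpq : p < q) (hqr : q < r)
    (hrs : r < s) (a b c d : Fin 2) :
    (Finset.univ.filter fun l => update₄ x p q r s a b c d l = 0) =
      (if a = 0 then insert p else id) ((if b = 0 then insert q else id)
        ((if c = 0 then insert r else id) ((if d = 0 then insert s else id)
          ((Finset.univ.filter fun l => x l = 0) \ {p, q, r, s})))) := by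
  have hpr := hpq.trans hqr
  have hqs := hqr.trans hrs
  have hps := hpr.trans hrs
  have key : ∀ (a : Fin 2) (p l : Fin n) (J : Finset (Fin n)),
      l ∈ (if a = 0 then insert p else id : Finset (Fin n) → Finset (Fin n)) J ↔
        (a = 0 ∧ l = p) ∨ l ∈ J := by
    intro a p l J
    split_ifs with h <;> simp [h]
  ext l
  simp only [key, Finset.mem_filter, Finset.mem_univ, true_and, update₄_apply, Finset.mem_sdiff,
    Finset.mem_insert, Finset.mem_singleton, not_or]
  by_cases h1 : l = s
  · subst h1; simp [hrs.ne', hqs.ne', hps.ne']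
  by_cases h2 : l = r
  · subst h2; simp [h1, hqr.ne', hpr.ne']
  by_cases h3 : l = q
  · subst h3; simp [h1, h2, hpq.ne']
  by_cases h4 : l = p
  · subst h4; simp [h1, h2, h3]
  simp [h1, h2, h3, h4]

/-- The Pfaffians are indexed by the zeros of the word. Exchanging 0 and 1 preserves both quadrics,
so the complement costs no sign. -/
theorem fourTermRelations_pfaffian {M : Matrix (Fin n) (Fin n) ℂ} (hM : M.transpose = -M) :
    FourTermRelations fun x => pfaffian M (Finset.univ.filter fun l => x l = 0) := by
  intro x p q r s hpq hqr hrs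
  simp only [evenQuadric, oddQuadric, zeros_update₄ x hpq hqr hrs]
  set R := (Finset.univ.filter fun l => x l = 0) \ {p, q, r, s} with hR
  have hp : p ∉ R := by simp [hR]
  have hq : q ∉ R := by simp [hR]
  have hr : r ∉ R := by simp [hR]
  have hs : s ∉ R := by simp [hR]
  have he := pfaffian_four_term_even hM hpq hqr hrs hp hq hr hs
  have ho := pfaffian_four_term_odd hM hpq hqr hrs hp hq hr hs
  simp only [one_ne_zero, if_true, if_false, id]
  constructor
  · linear_combination he
  · linear_combination ho

theorem FourTermRelations.const_mul {t : (Fin n → Fin 2) → ℂ} (ht : FourTermRelations t) (c : ℂ) :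
    FourTermRelations fun x => c * t x := by
  intro x p q r s hpq hqr hrs
  obtain ⟨he, ho⟩ := ht x p q r s hpq hqr hrs
  simp only [evenQuadric, oddQuadric] at he ho ⊢
  constructor
  · linear_combination c ^ 2 * he
  · linear_combination c ^ 2 * ho

/-- The number of ones of `update₄ x p q r s a b c d`, up to the part away from `p, q, r, s`. -/
theorem card_ones_update₄ (x : Fin n → Fin 2) {p q r s : Fin n} (hpq : p < q) (hqr : q < r)
    (hrs : r < s) : ∃ m : ℕ, ∀ a b c d : Fin 2,
    (Finset.univ.filter fun l => update₄ x p q r s a b c d l = 1).card =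
      m + (a.val + b.val + c.val + d.val) := by
  have hpr := hpq.trans hqr
  have hqs := hqr.trans hrs
  have hps := hpr.trans hrs
  refine ⟨∑ l ∈ ({p, q, r, s} : Finset (Fin n))ᶜ, if x l = 1 then 1 else 0, fun a b c d => ?_⟩
  rw [Finset.card_filter, ← Finset.sum_compl_add_sum {p, q, r, s}]
  congr 1
  · refine Finset.sum_congr rfl fun l hl => ?_
    simp only [Finset.mem_compl, Finset.mem_insert, Finset.mem_singleton, not_or] at hl
    simp [update₄_apply, hl]
  · rw [Finset.sum_insert (by simp [hpq.ne, hpr.ne, hps.ne]),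
      Finset.sum_insert (by simp [hqr.ne, hqs.ne]),
      Finset.sum_insert (by simp [hrs.ne]), Finset.sum_singleton]
    have key : ∀ a : Fin 2, (if a = 1 then 1 else 0) = a.val := by decide
    simp [update₄_apply, hpq.ne, hpr.ne, hps.ne, hqr.ne, hqs.ne, hrs.ne, key]
    ring

/-- The part of even parity of a function of binary words. -/
def evenPart (t : (Fin n → Fin 2) → ℂ) (x : Fin n → Fin 2) : ℂ :=
  if Even (Finset.univ.filter fun l => x l = 1).card then t x else 0

/-- If the even part of `t` satisfies the four-term relations, then `t` satisfies at any four
positions the relation whose parity fits. -/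
theorem quadric_of_evenPart {t : (Fin n → Fin 2) → ℂ} (ht : FourTermRelations (evenPart t))
    (x : Fin n → Fin 2) {p q r s : Fin n} (hpq : p < q) (hqr : q < r) (hrs : r < s) :
    ∃ m : ℕ, (∀ a b c d : Fin 2,
        (Finset.univ.filter fun l => update₄ x p q r s a b c d l = 1).card =
          m + (a.val + b.val + c.val + d.val)) ∧
      (Even m → evenQuadric (fun a b c d => t (update₄ x p q r s a b c d)) = 0) ∧
      (¬ Even m → oddQuadric (fun a b c d => t (update₄ x p q r s a b c d)) = 0) := by
  obtain ⟨m, hm⟩ := card_ones_update₄ x hpq hqr hrs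
  obtain ⟨he, ho⟩ := ht x p q r s hpq hqr hrs
  -- The words in `evenQuadric` have 0, 2 or 4 ones at the four sites, those in `oddQuadric` 1 or 3.
  -- In the quadric that fits the parity of `m` every word has even weight, so `evenPart t` agrees
  -- with `t` there.
  refine ⟨m, hm, fun h => ?_, fun h => ?_⟩
  · simpa [evenQuadric, evenPart, hm, h, Nat.even_add, Nat.even_add_one] using he
  · simpa [oddQuadric, evenPart, hm, h, Nat.even_add, Nat.even_add_one] using ho

end FourTerm
end PfaffianCogates
namespace PfaffianCogates

/-! ### Coordinates as evaluations, and the tensors at hand -/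

section Coordinates

variable {n : ℕ}

/-- The coordinates of a tensor in the basis of the covectors `⟨x₁ ⋯ xₙ|`. -/
noncomputable def coord (T : Cotensor n) (x : Fin n → Fin 2) : ℂ := (braBasis n).repr T x

/-- Evaluation of an element of `((ℂ²)^*)^{⊗ n}` at `v₁ ⊗ ⋯ ⊗ vₙ`. -/
noncomputable def evalAt (v : Fin n → Fin 2 → ℂ) : Cotensor n →ₗ[ℂ] ℂ :=
  PiTensorProduct.lift ((MultilinearMap.mkPiAlgebra ℂ (Fin n) ℂ).compLinearMap
    fun i => Module.Dual.eval ℂ _ (v i))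

theorem evalAt_tprod (v : Fin n → Fin 2 → ℂ) (f : Fin n → Module.Dual ℂ (Fin 2 → ℂ)) :
    evalAt v (PiTensorProduct.tprod ℂ f) = ∏ i, f i (v i) := by
  simp [evalAt]

theorem dualStdBasis_apply (a : Fin 2) (v : Fin 2 → ℂ) : dualStdBasis a v = v a := by
  simp [dualStdBasis]

theorem evalAt_bra (v : Fin n → Fin 2 → ℂ) (x : Fin n → Fin 2) :
    evalAt v (bra x) = ∏ i, v i (x i) := by
  simp [bra, evalAt_tprod, dualStdBasis_apply]

theorem coord_bra (x y : Fin n → Fin 2) : coord (bra y) x = if y = x then 1 else 0 := by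
  rw [coord, ← braBasis_apply, Module.Basis.repr_self, Finsupp.single_apply]

theorem coord_zero (x : Fin n → Fin 2) : coord (0 : Cotensor n) x = 0 := by simp [coord]

/-- Evaluations turn the group action into substitution and tensor products into products, which
makes the coordinates of the orbit computable. -/
theorem coord_eq_evalAt (T : Cotensor n) (x : Fin n → Fin 2) :
    coord T x = evalAt (fun i => Pi.single (x i) 1) T := by
  have : (Finsupp.lapply x ∘ₗ (braBasis n).repr.toLinearMap : Cotensor n →ₗ[ℂ] ℂ) =
      evalAt fun i => Pi.single (x i) 1 := by
    refine (braBasis n).ext fun y => ?_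
    rw [braBasis_apply, evalAt_bra]
    change coord (bra y) x = _
    rw [coord_bra]
    split_ifs with h
    · simp [h]
    · obtain ⟨i, hi⟩ := Function.ne_iff.1 h
      exact (Finset.prod_eq_zero (Finset.mem_univ i) (by simp [hi])).symm
  exact LinearMap.congr_fun this T

theorem coord_evenProj (T : Cotensor n) : coord (evenProj n T) = evenPart (coord T) := by
  ext x
  have : (Finsupp.lapply x ∘ₗ (braBasis n).repr.toLinearMap : Cotensor n →ₗ[ℂ] ℂ) ∘ₗ evenProj n =
      (if Even (Finset.univ.filter fun l => x l = 1).card then (1 : ℂ) else 0) •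
        (Finsupp.lapply x ∘ₗ (braBasis n).repr.toLinearMap : Cotensor n →ₗ[ℂ] ℂ) := by
    refine (braBasis n).ext fun y => ?_
    rw [LinearMap.comp_apply, evenProj, Module.Basis.constr_basis, braBasis_apply,
      LinearMap.smul_apply, smul_eq_mul]
    change coord _ x = _ * coord (bra y) x
    rw [coord_bra]
    by_cases hxy : y = x
    · subst hxy
      by_cases h : Even (Finset.univ.filter fun l => y l = 1).card
      · simp [h, coord_bra]
      · simp [h, coord_zero]
    · split_ifs <;> simp [coord_bra, hxy, coord_zero]
  have h := LinearMap.congr_fun this T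
  change coord (evenProj n T) x = _ * coord T x at h
  rw [h, evenPart]
  split_ifs <;> simp

theorem coord_subPfaffianDual (M : Matrix (Fin n) (Fin n) ℂ) (x : Fin n → Fin 2) :
    coord (subPfaffianDual M) x = pfaffian M (Finset.univ.filter fun l => x l = 0) := by
  have h : coord (subPfaffianDual M) x = ∑ I, pfaffian M I * coord (bra (chi Iᶜ)) x := by
    simp [subPfaffianDual, coord]
  rw [h, Finset.sum_eq_single (Finset.univ.filter fun l => x l = 0)]
  · rw [coord_bra, if_pos, mul_one]
    ext l
    rcases Fin.exists_fin_two.1 ⟨x l, rfl⟩ with h | h <;> simp [chi, h]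
  · intro I _ hI
    rw [coord_bra, if_neg, mul_zero]
    rintro rfl
    exact hI (by ext l; simp [chi])
  · simp

theorem coord_smul (c : ℂ) (T : Cotensor n) (x : Fin n → Fin 2) :
    coord (c • T) x = c * coord T x := by
  simp [coord]

theorem eq_zero_of_coord {T : Cotensor n} (h : ∀ x, coord T x = 0) : T = 0 :=
  (braBasis n).repr.map_eq_zero_iff.1 (Finsupp.ext h)

theorem fourTermRelations_smul_cogate {P : Cotensor n} (hP : P ∈ cogates n) (c : ℂ) :
    FourTermRelations (coord (c • P)) := by
  obtain ⟨M, hM, rfl⟩ := hP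
  have := (fourTermRelations_pfaffian hM).const_mul c
  convert this using 2 with x
  rw [coord_smul, coord_subPfaffianDual]

/-- The coefficient of `⟨1⋯1|` in an elementary cogate is the empty Pfaffian, which is 1. -/
theorem cogateMultiple_ne_zero {T : Cotensor n} (hT : T ∈ cogateMultiples n) : T ≠ 0 := by
  obtain ⟨c, hc, P, ⟨M, -, rfl⟩, rfl⟩ := hT
  intro h
  have h1 : coord (c • subPfaffianDual M) (fun _ => 1) = 0 := by simp [h, coord]
  rw [coord_smul, coord_subPfaffianDual] at h1
  rw [Finset.filter_false_of_mem (by simp), pfaffian] at h1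
  simp [hc] at h1

theorem evalAt_act (v : Fin n → Fin 2 → ℂ) (g : Fin n → GL (Fin 2) ℂ) (T : Cotensor n) :
    evalAt v (act g T) =
      evalAt (fun j => ((g j)⁻¹ : GL (Fin 2) ℂ).val.mulVec (v j)) T := by
  have : evalAt v ∘ₗ act g =
      evalAt (fun j => ((g j)⁻¹ : GL (Fin 2) ℂ).val.mulVec (v j)) := by
    refine PiTensorProduct.ext (MultilinearMap.ext fun f => ?_)
    simp only [LinearMap.compMultilinearMap_apply, LinearMap.comp_apply, act,
      PiTensorProduct.map_tprod, evalAt_tprod, LinearMap.dualMap_apply, Matrix.toLin'_apply]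
  exact LinearMap.congr_fun this T

theorem evalAt_mulEquiv {m : ℕ} (v : Fin (n + m) → Fin 2 → ℂ) (S : Cotensor n)
    (T : Cotensor m) :
    evalAt v (TensorPower.mulEquiv (S ⊗ₜ[ℂ] T)) =
      evalAt (fun i => v (Fin.castAdd m i)) S * evalAt (fun i => v (Fin.natAdd n i)) T := by
  have : evalAt v ∘ₗ (TensorPower.mulEquiv (R := ℂ) (M := Module.Dual ℂ (Fin 2 → ℂ))
      (n := n) (m := m)).toLinearMap =
      LinearMap.mul' ℂ ℂ ∘ₗ TensorProduct.map (evalAt fun i => v (Fin.castAdd m i))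
        (evalAt fun i => v (Fin.natAdd n i)) := by
    ext a b
    have h : TensorPower.mulEquiv (PiTensorProduct.tprod ℂ a ⊗ₜ[ℂ] PiTensorProduct.tprod ℂ b) =
        PiTensorProduct.tprod ℂ (Fin.append a b) := TensorPower.tprod_mul_tprod ℂ a b
    simp [h, evalAt_tprod, Fin.prod_univ_add]
  exact LinearMap.congr_fun this (S ⊗ₜ T)

/-- The site `j` of the `b`-th factor of `SWAP^{⊗ k}`. -/
def site {k : ℕ} (b : Fin k) (j : Fin 4) : Fin (4 * k) := ⟨4 * b + j, by omega⟩

theorem evalAt_swap (v : Fin 4 → Fin 2 → ℂ) :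
    evalAt v swap = (v 0 ⬝ᵥ v 2) * (v 1 ⬝ᵥ v 3) := by
  simp [swap, evalAt_bra, Fin.prod_univ_four, dotProduct, Fin.sum_univ_two]
  ring

theorem evalAt_swapPow : ∀ (k : ℕ) (v : Fin (4 * k) → Fin 2 → ℂ),
    evalAt v (swapPow k) = ∏ b : Fin k,
      (v (site b 0) ⬝ᵥ v (site b 2)) * (v (site b 1) ⬝ᵥ v (site b 3))
  | 0, v => by
    rw [swapPow]
    exact (evalAt_tprod v _).trans (by simp)
  | k + 1, v => by
    rw [swapPow, Fin.prod_univ_castSucc]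
    refine (evalAt_mulEquiv (n := 4 * k) (m := 4) v _ _).trans ?_
    rw [evalAt_swapPow k, evalAt_swap]
    rfl

end Coordinates
end PfaffianCogates
namespace PfaffianCogates

/-! ### Product functions: Segre quadrics and a determinantal invariant -/

section RankOne

/-- A function on a product which satisfies the quadrics of the Segre variety is a multiple of a
product of functions of one variable. -/
theorem exists_eq_prod_of_segre {E S : Type*} [Fintype E] [DecidableEq E] (F : (E → S) → ℂ)
    (hF : ∀ e σ τ, F σ * F τ = F (Function.update σ e (τ e)) * F (Function.update τ e (σ e)))
    {σ₀ : E → S} (h₀ : F σ₀ ≠ 0) :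
    ∃ (c : ℂ) (a : E → S → ℂ), ∀ σ, F σ = c * ∏ e, a e (σ e) := by
  refine ⟨F σ₀, fun e s => F (Function.update σ₀ e s) / F σ₀, fun σ => ?_⟩
  -- The passage from `σ₀` to `σ` changes one coordinate at a time; each change is one Segre
  -- quadric, paired with `σ₀`.
  have key : ∀ s : Finset E, F (s.piecewise σ σ₀) =
      F σ₀ * ∏ e ∈ s, F (Function.update σ₀ e (σ e)) / F σ₀ := by
    intro s
    induction s using Finset.induction_on with
    | empty => simp
    | insert e s he ih =>
      have h := hF e ((insert e s).piecewise σ σ₀) σ₀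
      have h1 : Function.update ((insert e s).piecewise σ σ₀) e (σ₀ e) = s.piecewise σ σ₀ := by
        ext l
        rcases eq_or_ne l e with rfl | hl
        · simp [he]
        · simp [hl, Finset.piecewise]
      rw [h1, Finset.piecewise_insert_self, ih] at h
      rw [Finset.prod_insert he]
      field_simp at h ⊢
      rw [h]
  simpa using key Finset.univ

/-- The multiplier `(-1)^(a + b)` of an edge. -/
def edgeSign (s : Fin 2 × Fin 2) : ℂ := if s.1 = s.2 then 1 else -1

/-- The complementary labelling of an edge. -/
def edgeFlip (s : Fin 2 × Fin 2) : Fin 2 × Fin 2 := (1 - s.1, 1 - s.2)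

/-- The invariant quadratic form on functions of edge labellings. -/
noncomputable def edgeForm {E : Type*} [Fintype E] [DecidableEq E]
    (F : (E → Fin 2 × Fin 2) → ℂ) : ℂ :=
  ∑ σ : E → Fin 2 × Fin 2, (∏ e, edgeSign (σ e)) * (F σ * F fun e => edgeFlip (σ e))

/-- The form is the tensor product over the edges of the form whose value at a matrix is twice its
determinant, so it factors on products. -/
theorem edgeForm_prod {E : Type*} [Fintype E] [DecidableEq E] (c : ℂ)
    (A : E → Matrix (Fin 2) (Fin 2) ℂ) :
    edgeForm (fun σ => c * ∏ e, A e (σ e).1 (σ e).2) = c ^ 2 * ∏ e, 2 * (A e).det := by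
  have h : ∀ e, 2 * (A e).det =
      ∑ s : Fin 2 × Fin 2, edgeSign s * (A e s.1 s.2 * A e (edgeFlip s).1 (edgeFlip s).2) := by
    intro e
    simp [Fintype.sum_prod_type, Fin.sum_univ_two, edgeSign, edgeFlip, Matrix.det_fin_two]
    ring
  simp_rw [h, Finset.prod_univ_sum, Fintype.piFinset_univ, Finset.mul_sum, edgeForm,
    Finset.prod_mul_distrib]
  refine Finset.sum_congr rfl fun σ _ => ?_
  ring

end RankOne

/-! ### Zariski closures and edge products -/

section Closure

theorem eval_eq_zero_of_mem_zariskiClosure {n : ℕ} {X : Set (Cotensor n)} {T : Cotensor n}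
    (hT : T ∈ zariskiClosure X) (p : MvPolynomial (Fin n → Fin 2) ℂ)
    (hp : ∀ S ∈ X, MvPolynomial.eval (coord S) p = 0) : MvPolynomial.eval (coord T) p = 0 := by
  have := hT p (by
    rw [MvPolynomial.mem_vanishingIdeal_iff]
    rintro _ ⟨S, hS, rfl⟩
    rw [MvPolynomial.aeval_eq_eval]
    exact hp S hS)
  rw [MvPolynomial.aeval_eq_eval] at this
  exact this

theorem fourTermRelations_of_mem_cogateCone {n : ℕ} {T : Cotensor n} (hT : T ∈ cogateCone n) :
    FourTermRelations (coord T) := by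
  intro x p q r s hpq hqr hrs
  let X (a b c d : Fin 2) : MvPolynomial (Fin n → Fin 2) ℂ :=
    MvPolynomial.X (update₄ x p q r s a b c d)
  have he := eval_eq_zero_of_mem_zariskiClosure hT
    (X 0 0 0 0 * X 1 1 1 1 - X 1 1 0 0 * X 0 0 1 1 + X 1 0 1 0 * X 0 1 0 1 -
      X 1 0 0 1 * X 0 1 1 0) (by
    rintro _ ⟨c, P, hP, rfl⟩
    simpa [X, evenQuadric] using (fourTermRelations_smul_cogate hP c x p q r s hpq hqr hrs).1)
  have ho := eval_eq_zero_of_mem_zariskiClosure hT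
    (X 1 0 0 0 * X 0 1 1 1 - X 0 1 0 0 * X 1 0 1 1 + X 0 0 1 0 * X 1 1 0 1 -
      X 0 0 0 1 * X 1 1 1 0) (by
    rintro _ ⟨c, P, hP, rfl⟩
    simpa [X, oddQuadric] using (fourTermRelations_smul_cogate hP c x p q r s hpq hqr hrs).2)
  exact ⟨by simpa [X, evenQuadric] using he, by simpa [X, oddQuadric] using ho⟩

variable {k : ℕ}

/-- The first site of an edge of the pairing that underlies `SWAP^{⊗ k}`. -/
def leftSite (e : Fin k × Fin 2) : Fin (4 * k) := ⟨4 * e.1 + e.2, by omega⟩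

/-- The second site of an edge of the pairing that underlies `SWAP^{⊗ k}`. -/
def rightSite (e : Fin k × Fin 2) : Fin (4 * k) := ⟨4 * e.1 + e.2 + 2, by omega⟩

/-- The binary word with the given labels at the edges. -/
def wordOf (σ : Fin k × Fin 2 → Fin 2 × Fin 2) (l : Fin (4 * k)) : Fin 2 :=
  let s := σ (⟨l / 4, by omega⟩, ⟨l % 2, by omega⟩)
  if l.val % 4 < 2 then s.1 else s.2

theorem wordOf_leftSite (σ : Fin k × Fin 2 → Fin 2 × Fin 2) (e : Fin k × Fin 2) :
    wordOf σ (leftSite e) = (σ e).1 := by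
  obtain ⟨⟨b, hb⟩, ⟨r, hr⟩⟩ := e
  have h1 : (4 * b + r) / 4 = b := by omega
  have h2 : (4 * b + r) % 2 = r := by omega
  have h3 : (4 * b + r) % 4 < 2 := by omega
  simp only [wordOf, leftSite, h1, h2, h3, if_true]

theorem wordOf_rightSite (σ : Fin k × Fin 2 → Fin 2 × Fin 2) (e : Fin k × Fin 2) :
    wordOf σ (rightSite e) = (σ e).2 := by
  obtain ⟨⟨b, hb⟩, ⟨r, hr⟩⟩ := e
  have h1 : (4 * b + r + 2) / 4 = b := by omega
  have h2 : (4 * b + r + 2) % 2 = r := by omega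
  have h3 : ¬ (4 * b + r + 2) % 4 < 2 := by omega
  simp only [wordOf, rightSite, h1, h2, h3, if_false]

theorem wordOf_labels (x : Fin (4 * k) → Fin 2) :
    wordOf (fun e => (x (leftSite e), x (rightSite e))) = x := by
  ext l
  simp only [wordOf]
  split_ifs with h
  · congr 2; ext; simp only [leftSite]; omega
  · congr 2; ext; simp only [rightSite]; omega

/-- Functions on binary words which are nonzero multiples of products of nondegenerate bilinear
forms, one for each edge of the pairing that underlies `SWAP^{⊗ k}`. -/
def IsEdgeProduct (t : (Fin (4 * k) → Fin 2) → ℂ) : Prop :=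
  ∃ (c : ℂ) (A : Fin k × Fin 2 → Matrix (Fin 2) (Fin 2) ℂ), (∀ e, (A e).det ≠ 0) ∧
    ∀ x, t x = c * ∏ e, A e (x (leftSite e)) (x (rightSite e))

theorem coord_act_swapPow (g : Fin (4 * k) → GL (Fin 2) ℂ) (x : Fin (4 * k) → Fin 2) :
    coord (act g (swapPow k)) x = ∏ e : Fin k × Fin 2,
      (((g (leftSite e))⁻¹ : GL (Fin 2) ℂ).val.transpose *
        ((g (rightSite e))⁻¹ : GL (Fin 2) ℂ).val) (x (leftSite e)) (x (rightSite e)) := by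
  rw [coord_eq_evalAt, evalAt_act, evalAt_swapPow, Fintype.prod_prod_type]
  refine Finset.prod_congr rfl fun b _ => ?_
  rw [Fin.prod_univ_two]
  simp only [Matrix.mulVec_single_one]
  rfl

theorem isEdgeProduct_of_mem_orbitGL {T : Cotensor (4 * k)} (hT : T ∈ orbitGL (swapPow k)) :
    IsEdgeProduct (coord T) := by
  obtain ⟨g, rfl⟩ := hT
  refine ⟨1, _, fun e => ?_, fun x => by rw [one_mul]; exact coord_act_swapPow g x⟩
  rw [Matrix.det_mul, Matrix.det_transpose]
  exact mul_ne_zero (Matrix.GeneralLinearGroup.det_ne_zero _)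
    (Matrix.GeneralLinearGroup.det_ne_zero _)

theorem coord_of_mem_orbitSL {T : Cotensor (4 * k)} (hT : T ∈ orbitSL (swapPow k)) :
    ∃ A : Fin k × Fin 2 → Matrix (Fin 2) (Fin 2) ℂ, (∀ e, (A e).det = 1) ∧
      ∀ x, coord T x = ∏ e, A e (x (leftSite e)) (x (rightSite e)) := by
  obtain ⟨g, rfl⟩ := hT
  refine ⟨_, fun e => ?_, coord_act_swapPow _⟩
  rw [Matrix.det_mul, Matrix.det_transpose]
  simp

/-- On the SL-orbit all determinants are 1, so the Segre quadrics hold and `edgeForm` has a constant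
nonzero value. Both conditions pass to the closure: the first gives the product form, the second
excludes singular factors. -/
theorem isEdgeProduct_of_mem_zariskiClosure {T : Cotensor (4 * k)}
    (hT : T ∈ zariskiClosure (orbitSL (swapPow k))) : IsEdgeProduct (coord T) := by
  set F : (Fin k × Fin 2 → Fin 2 × Fin 2) → ℂ := fun σ => coord T (wordOf σ) with hF
  have hform : edgeForm F = 2 ^ Fintype.card (Fin k × Fin 2) := by
    have := eval_eq_zero_of_mem_zariskiClosure hT
      (∑ σ : Fin k × Fin 2 → Fin 2 × Fin 2, MvPolynomial.C (∏ e, edgeSign (σ e)) *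
        (MvPolynomial.X (wordOf σ) * MvPolynomial.X (wordOf fun e => edgeFlip (σ e))) -
        MvPolynomial.C (2 ^ Fintype.card (Fin k × Fin 2))) (by
      intro S hS
      obtain ⟨A, hA, hS⟩ := coord_of_mem_orbitSL hS
      have h := edgeForm_prod 1 A
      simp only [hA, mul_one, one_pow, one_mul, Finset.prod_const, Finset.card_univ,
        edgeForm] at h
      simp only [map_sub, map_sum, map_mul, MvPolynomial.eval_C, MvPolynomial.eval_X, hS,
        wordOf_leftSite, wordOf_rightSite, map_pow]
      rw [h, sub_self])
    simpa [edgeForm, hF, sub_eq_zero] using this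
  have hsegre : ∀ e σ τ, F σ * F τ =
      F (Function.update σ e (τ e)) * F (Function.update τ e (σ e)) := by
    intro e σ τ
    have := eval_eq_zero_of_mem_zariskiClosure hT
      (MvPolynomial.X (wordOf σ) * MvPolynomial.X (wordOf τ) -
        MvPolynomial.X (wordOf (Function.update σ e (τ e))) *
          MvPolynomial.X (wordOf (Function.update τ e (σ e)))) (by
      intro S hS
      obtain ⟨A, -, hS⟩ := coord_of_mem_orbitSL hS
      simp only [map_sub, map_mul, MvPolynomial.eval_X, hS, wordOf_leftSite, wordOf_rightSite]
      rw [sub_eq_zero, ← Finset.prod_mul_distrib, ← Finset.prod_mul_distrib]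
      refine Finset.prod_congr rfl fun f _ => ?_
      rcases eq_or_ne f e with rfl | hf
      · simp [mul_comm]
      · simp [hf])
    simpa [hF, sub_eq_zero] using this
  have hne : edgeForm F ≠ 0 := by rw [hform]; exact pow_ne_zero _ two_ne_zero
  obtain ⟨σ₀, h₀⟩ : ∃ σ, F σ ≠ 0 := by
    by_contra! h
    exact hne (by simp [edgeForm, h])
  obtain ⟨c, a, ha⟩ := exists_eq_prod_of_segre F hsegre h₀
  refine ⟨c, fun e => Matrix.of fun i j => a e (i, j), fun e he => ?_, fun x => ?_⟩
  · have h := edgeForm_prod c fun e => Matrix.of fun i j => a e (i, j)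
    rw [Finset.prod_eq_zero (Finset.mem_univ e) (by simp [he]), mul_zero] at h
    refine hne (Eq.trans ?_ h)
    congr 1
    ext σ
    rw [ha σ]
    rfl
  · have h := ha fun e => (x (leftSite e), x (rightSite e))
    simp only [hF, wordOf_labels] at h
    exact h

end Closure
end PfaffianCogates
namespace PfaffianCogates

/-! ### Crossing edges against the four-term relations -/

section Obstruction

variable {k : ℕ}

theorem leftSite_inj {e f : Fin k × Fin 2} : leftSite e = leftSite f ↔ e = f := by
  obtain ⟨⟨b, hb⟩, ⟨r, hr⟩⟩ := e
  obtain ⟨⟨b', hb'⟩, ⟨r', hr'⟩⟩ := f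
  simp only [leftSite, Fin.mk.injEq, Prod.mk.injEq]
  omega

theorem rightSite_inj {e f : Fin k × Fin 2} : rightSite e = rightSite f ↔ e = f := by
  obtain ⟨⟨b, hb⟩, ⟨r, hr⟩⟩ := e
  obtain ⟨⟨b', hb'⟩, ⟨r', hr'⟩⟩ := f
  simp only [rightSite, Fin.mk.injEq, Prod.mk.injEq]
  omega

theorem leftSite_ne_rightSite (e f : Fin k × Fin 2) : leftSite e ≠ rightSite f := by
  obtain ⟨⟨b, hb⟩, ⟨r, hr⟩⟩ := e
  obtain ⟨⟨b', hb'⟩, ⟨r', hr'⟩⟩ := f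
  simp only [leftSite, rightSite, ne_eq, Fin.mk.injEq]
  omega

/-- An end of an edge, the first one for `false` and the second one for `true`. -/
def endSite (e : Fin k × Fin 2) : Bool → Fin (4 * k)
  | false => leftSite e
  | true => rightSite e

/-- The entry of `A` with label `a` at the end `σ` of the edge and label `u` at the other end. -/
def endEntry (A : Matrix (Fin 2) (Fin 2) ℂ) (σ : Bool) (u a : Fin 2) : ℂ :=
  if σ then A u a else A a u

theorem edgeProduct_split {t : (Fin (4 * k) → Fin 2) → ℂ} {c : ℂ}
    {A : Fin k × Fin 2 → Matrix (Fin 2) (Fin 2) ℂ}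
    (ht : ∀ x, t x = c * ∏ e, A e (x (leftSite e)) (x (rightSite e)))
    (s : Finset (Fin k × Fin 2)) {x y : Fin (4 * k) → Fin 2}
    (hxy : ∀ e ∉ s, y (leftSite e) = x (leftSite e) ∧ y (rightSite e) = x (rightSite e)) :
    t y = (∏ e ∈ s, A e (y (leftSite e)) (y (rightSite e))) *
      (c * ∏ e ∈ sᶜ, A e (x (leftSite e)) (x (rightSite e))) := by
  rw [ht, ← Finset.prod_mul_prod_compl s]
  have : ∏ e ∈ sᶜ, A e (y (leftSite e)) (y (rightSite e)) =
      ∏ e ∈ sᶜ, A e (x (leftSite e)) (x (rightSite e)) :=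
    Finset.prod_congr rfl fun e he => by
      rw [(hxy e (Finset.mem_compl.1 he)).1, (hxy e (Finset.mem_compl.1 he)).2]
  rw [this]
  ring

/-- If exactly one of an end of `f` and an end of `g` lies between the two ends of `e`, then one
of the two cannot have both labels. -/
theorem endEntry_mul_eq_zero {t : (Fin (4 * k) → Fin 2) → ℂ} {c : ℂ}
    {A : Fin k × Fin 2 → Matrix (Fin 2) (Fin 2) ℂ} (hA : ∀ e, (A e).det ≠ 0)
    (ht : ∀ x, t x = c * ∏ e, A e (x (leftSite e)) (x (rightSite e)))
    (hr : FourTermRelations (evenPart t)) {x : Fin (4 * k) → Fin 2} (hx : t x ≠ 0)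
    {e f g : Fin k × Fin 2} (hef : e ≠ f) (heg : e ≠ g) (hfg : f ≠ g) (σ τ : Bool)
    (h₁ : leftSite e < endSite f σ) (h₂ : endSite f σ < rightSite e)
    (h₃ : rightSite e < endSite g τ) (u v : Fin 2) :
    (endEntry (A f) σ u 0 * endEntry (A f) σ u 1) *
      (endEntry (A g) τ v 0 * endEntry (A g) τ v 1) = 0 := by
  -- The ends of `f` and `g` outside the quadric get the labels `u` and `v`. The word `x` only
  -- serves to make the common factor `K` of the other edges nonzero.
  set x' := Function.update (Function.update x (endSite f !σ) u) (endSite g !τ) v with hx'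
  set K := c * ∏ h ∈ ({e, f, g} : Finset (Fin k × Fin 2))ᶜ,
    A h (x (leftSite h)) (x (rightSite h)) with hK
  have hK0 : K ≠ 0 := by
    intro h
    rw [edgeProduct_split ht {e, f, g} (x := x) (fun _ _ => ⟨rfl, rfl⟩), ← hK, h, mul_zero] at hx
    exact hx rfl
  have key : ∀ a b c' d, t (update₄ x' (leftSite e) (endSite f σ) (rightSite e) (endSite g τ)
      a b c' d) = A e a c' * endEntry (A f) σ u b * endEntry (A g) τ v d * K := by
    intro a b c' d
    rw [edgeProduct_split ht {e, f, g} (x := x), ← hK, Finset.prod_insert (by simp [hef, heg]),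
      Finset.prod_insert (by simp [hfg]), Finset.prod_singleton]
    · cases σ <;> cases τ <;>
        simp [update₄_apply, hx', endSite, endEntry, leftSite_inj,
          rightSite_inj, leftSite_ne_rightSite, (leftSite_ne_rightSite _ _).symm, hef, heg, hfg,
          hef.symm, heg.symm, hfg.symm, mul_assoc]
    · intro h hh
      simp only [Finset.mem_insert, Finset.mem_singleton, not_or] at hh
      cases σ <;> cases τ <;>
        simp [update₄_apply, hx', endSite, leftSite_inj,
          rightSite_inj, leftSite_ne_rightSite, (leftSite_ne_rightSite _ _).symm, hh]
  obtain ⟨m, -, he, ho⟩ := quadric_of_evenPart hr x' h₁ h₂ h₃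
  have hdet := hA e
  rw [Matrix.det_fin_two] at hdet
  -- Each of the four terms contains both labels of `f` and of `g`. Since the end of `f` separates
  -- the ends of `e`, the signs combine the entries of `A e` into twice the determinant, up to a
  -- sign depending on the parity.
  have : (2 * (A e 0 0 * A e 1 1 - A e 0 1 * A e 1 0) * K ^ 2) *
      ((endEntry (A f) σ u 0 * endEntry (A f) σ u 1) *
      (endEntry (A g) τ v 0 * endEntry (A g) τ v 1)) = 0 := by
    by_cases hm : Even m
    · have := he hm
      simp only [evenQuadric, key] at this
      linear_combination this
    · have := ho hm
      simp only [oddQuadric, key] at this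
      linear_combination -this
  exact (mul_eq_zero.1 this).resolve_left
    (mul_ne_zero (mul_ne_zero two_ne_zero hdet) (pow_ne_zero 2 hK0))

/-- The two matrices of a block do not mix parities, tested at the inner ends of the edges. -/
def IsMonomialBlock (A B : Matrix (Fin 2) (Fin 2) ℂ) : Prop :=
  (∀ u, A u 0 * A u 1 = 0) ∧ ∀ u, B 0 u * B 1 u = 0

/-- Mixed products at inner ends in both blocks would have a nonzero product, contrary to the
quadric through the edge that crosses in the first block. -/
theorem isMonomialBlock_or {t : (Fin (4 * k) → Fin 2) → ℂ} {c : ℂ}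
    {A : Fin k × Fin 2 → Matrix (Fin 2) (Fin 2) ℂ} (hA : ∀ e, (A e).det ≠ 0)
    (ht : ∀ x, t x = c * ∏ e, A e (x (leftSite e)) (x (rightSite e)))
    (hr : FourTermRelations (evenPart t)) {x : Fin (4 * k) → Fin 2} (hx : t x ≠ 0)
    {b b' : Fin k} (hb : b < b') :
    IsMonomialBlock (A (b, 0)) (A (b, 1)) ∨ IsMonomialBlock (A (b', 0)) (A (b', 1)) := by
  have hb' : b.val < b'.val := hb
  have key : ∀ (r r' : Fin 2) (u v : Fin 2),
      (endEntry (A (b, r)) (r == 0) u 0 * endEntry (A (b, r)) (r == 0) u 1) *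
        (endEntry (A (b', r')) (r' == 0) v 0 * endEntry (A (b', r')) (r' == 0) v 1) = 0 := by
    intro r r' u v
    -- The other edge of block `b` encloses the inner end of edge `r`: the right end for `r = 0`,
    -- the left end for `r = 1`.
    refine endEntry_mul_eq_zero hA ht hr hx (e := (b, 1 - r)) ?_ ?_ ?_ _ _ ?_ ?_ ?_ u v
    · fin_cases r <;> simp
    · simp [hb.ne]
    · simp [hb.ne]
    · fin_cases r <;> simp [endSite, leftSite, rightSite]
    · fin_cases r <;> simp [endSite, leftSite, rightSite]
    · fin_cases r <;> fin_cases r' <;> simp [endSite, leftSite, rightSite] <;> omega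
  by_contra! h
  obtain ⟨h, h'⟩ := h
  have find : ∀ b : Fin k, ¬ IsMonomialBlock (A (b, 0)) (A (b, 1)) → ∃ r u,
      endEntry (A (b, r)) (r == 0) u 0 * endEntry (A (b, r)) (r == 0) u 1 ≠ 0 := by
    intro b hb
    by_contra! hc
    exact hb ⟨fun u => by simpa [endEntry] using hc 0 u, fun u => by simpa [endEntry] using hc 1 u⟩
  obtain ⟨r, u, hu⟩ := find b h
  obtain ⟨r', v, hv⟩ := find b' h'
  exact mul_ne_zero hu hv (key r r' u v)

theorem update₄_self {n : ℕ} (x : Fin n → Fin 2) (p q r s : Fin n) :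
    update₄ x p q r s (x p) (x q) (x r) (x s) = x := by
  simp [update₄]

/-- An invertible matrix with a zero in every row, or in every column, is diagonal or antidiagonal;
the position of one nonzero entry decides which. -/
theorem diagonal_or_antidiagonal {A : Matrix (Fin 2) (Fin 2) ℂ} (hA : A.det ≠ 0)
    (h : (∀ u, A u 0 * A u 1 = 0) ∨ ∀ u, A 0 u * A 1 u = 0) {a b : Fin 2} (hab : A a b ≠ 0) :
    (Even (a.val + b.val) ∧ A 0 0 * A 1 1 ≠ 0 ∧ A 0 1 * A 1 0 = 0) ∨
      (¬ Even (a.val + b.val) ∧ A 0 0 * A 1 1 = 0 ∧ A 0 1 * A 1 0 ≠ 0) := by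
  rw [Matrix.det_fin_two] at hA
  have h' : (A 0 0 * A 0 1 = 0 ∧ A 1 0 * A 1 1 = 0) ∨ (A 0 0 * A 1 0 = 0 ∧ A 0 1 * A 1 1 = 0) :=
    h.imp (fun h => ⟨h 0, h 1⟩) fun h => ⟨h 0, h 1⟩
  rcases Fin.exists_fin_two.1 ⟨a, rfl⟩ with rfl | rfl <;>
    rcases Fin.exists_fin_two.1 ⟨b, rfl⟩ with rfl | rfl <;>
    simp at hab ⊢ <;> grind

/-- A monomial block is incompatible with the quadric at its four sites. -/
theorem not_isMonomialBlock {t : (Fin (4 * k) → Fin 2) → ℂ} {c : ℂ}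
    {A : Fin k × Fin 2 → Matrix (Fin 2) (Fin 2) ℂ} (hA : ∀ e, (A e).det ≠ 0)
    (ht : ∀ x, t x = c * ∏ e, A e (x (leftSite e)) (x (rightSite e)))
    (hr : FourTermRelations (evenPart t)) {x : Fin (4 * k) → Fin 2} (hx : evenPart t x ≠ 0)
    (b : Fin k) : ¬ IsMonomialBlock (A (b, 0)) (A (b, 1)) := by
  rintro ⟨hm₀, hm₁⟩
  have hne : (b, (0 : Fin 2)) ≠ (b, 1) := by simp
  set K := c * ∏ h ∈ ({(b, 0), (b, 1)} : Finset (Fin k × Fin 2))ᶜ,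
    A h (x (leftSite h)) (x (rightSite h)) with hK
  have key : ∀ a₁ a₂ a₃ a₄, t (update₄ x (leftSite (b, 0)) (leftSite (b, 1)) (rightSite (b, 0))
      (rightSite (b, 1)) a₁ a₂ a₃ a₄) = A (b, 0) a₁ a₃ * A (b, 1) a₂ a₄ * K := by
    intro a₁ a₂ a₃ a₄
    rw [edgeProduct_split ht {(b, 0), (b, 1)} (x := x), ← hK, Finset.prod_insert (by simp),
      Finset.prod_singleton]
    · simp [update₄_apply, leftSite_inj, rightSite_inj, leftSite_ne_rightSite]
    · intro h hh
      simp only [Finset.mem_insert, Finset.mem_singleton, not_or] at hh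
      simp [update₄_apply, leftSite_inj, rightSite_inj, leftSite_ne_rightSite,
        (leftSite_ne_rightSite _ _).symm, hh]
  obtain ⟨m, hm, he, ho⟩ := quadric_of_evenPart hr x
    (p := leftSite (b, 0)) (q := leftSite (b, 1)) (r := rightSite (b, 0)) (s := rightSite (b, 1))
    (by simp [leftSite]) (by simp [leftSite, rightSite])
    (by simp [rightSite])
  have hm' := hm (x (leftSite (b, 0))) (x (leftSite (b, 1))) (x (rightSite (b, 0)))
    (x (rightSite (b, 1)))
  have hx' := key (x (leftSite (b, 0))) (x (leftSite (b, 1))) (x (rightSite (b, 0)))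
    (x (rightSite (b, 1)))
  rw [update₄_self] at hm' hx'
  have hev : Even (Finset.univ.filter fun l => x l = 1).card := by
    by_contra h
    exact hx (if_neg h)
  rw [evenPart, if_pos hev, hx'] at hx
  rw [hm'] at hev
  simp only [evenQuadric, oddQuadric, key] at he ho
  generalize x (leftSite (b, 0)) = a₁ at *
  generalize x (leftSite (b, 1)) = a₂ at *
  generalize x (rightSite (b, 0)) = a₃ at *
  generalize x (rightSite (b, 1)) = a₄ at *
  have hK0 : K ≠ 0 := right_ne_zero_of_mul hx
  have hx1 := left_ne_zero_of_mul (left_ne_zero_of_mul hx)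
  have hx2 := right_ne_zero_of_mul (left_ne_zero_of_mul hx)
  have hK2 : (2 : ℂ) * K ^ 2 ≠ 0 := mul_ne_zero two_ne_zero (pow_ne_zero 2 hK0)
  -- The terms of each quadric coincide in pairs, which gives the factor 2.
  have he' : Even m → A (b, 0) 0 0 * A (b, 0) 1 1 * (A (b, 1) 0 0 * A (b, 1) 1 1) -
      A (b, 0) 0 1 * A (b, 0) 1 0 * (A (b, 1) 0 1 * A (b, 1) 1 0) = 0 := fun h =>
    (mul_eq_zero.1 (by linear_combination he h)).resolve_left hK2
  have ho' : ¬ Even m → A (b, 0) 0 1 * A (b, 0) 1 0 * (A (b, 1) 0 0 * A (b, 1) 1 1) -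
      A (b, 0) 0 0 * A (b, 0) 1 1 * (A (b, 1) 0 1 * A (b, 1) 1 0) = 0 := fun h =>
    (mul_eq_zero.1 (by linear_combination ho h)).resolve_left hK2
  -- As `x` has even weight, the shapes of the two matrices determine the parity of `m`. In each of
  -- the four cases the quadric of that parity keeps exactly one nonzero term.
  have hpar : Even m ↔ (Even (a₁.val + a₃.val) ↔ Even (a₂.val + a₄.val)) := by
    rw [← Nat.even_add, Nat.even_add.1 hev]
    ring_nf
  rcases diagonal_or_antidiagonal (hA (b, 0)) (Or.inl hm₀) hx1 with ⟨h1, h2, h3⟩ | ⟨h1, h2, h3⟩ <;>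
    rcases diagonal_or_antidiagonal (hA (b, 1)) (Or.inr hm₁) hx2 with
      ⟨h4, h5, h6⟩ | ⟨h4, h5, h6⟩ <;>
    simp only [h1, h4, h2, h3, h5, h6, iff_true, iff_false, not_true,
      zero_mul, mul_zero, sub_zero, zero_sub, neg_eq_zero] at hpar he' ho'
  · exact mul_ne_zero h2 h5 (he' hpar)
  · exact mul_ne_zero h2 h6 (ho' hpar)
  · exact mul_ne_zero h3 h5 (ho' hpar)
  · exact mul_ne_zero h3 h6 (he' hpar)

theorem evenPart_eq_zero_of_isEdgeProduct (hk : 2 ≤ k) {t : (Fin (4 * k) → Fin 2) → ℂ}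
    (ht : IsEdgeProduct t) (hr : FourTermRelations (evenPart t)) (x : Fin (4 * k) → Fin 2) :
    evenPart t x = 0 := by
  obtain ⟨c, A, hA, ht⟩ := ht
  by_contra hx
  have hx' : t x ≠ 0 := by
    intro h
    simp [evenPart, h] at hx
  -- Two blocks exist because `2 ≤ k`.
  have hlt : (⟨0, by omega⟩ : Fin k) < ⟨1, by omega⟩ := by simp
  rcases isMonomialBlock_or hA ht hr hx' hlt with h | h
  · exact not_isMonomialBlock hA ht hr hx _ h
  · exact not_isMonomialBlock hA ht hr hx _ h

theorem evenProj_eq_zero_of_isEdgeProduct (hk : 2 ≤ k) {T : Cotensor (4 * k)}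
    (hT : IsEdgeProduct (coord T)) (hr : FourTermRelations (coord (evenProj (4 * k) T))) :
    evenProj (4 * k) T = 0 := by
  refine eq_zero_of_coord fun x => ?_
  rw [coord_evenProj] at hr ⊢
  exact evenPart_eq_zero_of_isEdgeProduct hk hT hr x

end Obstruction

end PfaffianCogates

theorem mainTheorem3 (k : ℕ) (hk : 2 ≤ k) :
    (PfaffianCogates.evenProj (4 * k) ''
        PfaffianCogates.zariskiClosure (PfaffianCogates.orbitSL (PfaffianCogates.swapPow k))) ∩
      (PfaffianCogates.cogateCone (4 * k) \ {0}) = ∅ ∧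
    (PfaffianCogates.evenProj (4 * k) ''
        PfaffianCogates.orbitGL (PfaffianCogates.swapPow k)) ∩
      PfaffianCogates.cogateMultiples (4 * k) = ∅ := by
  constructor
  · refine Set.eq_empty_iff_forall_notMem.2 ?_
    rintro _ ⟨⟨T, hT, rfl⟩, hcone, hne⟩
    exact hne (PfaffianCogates.evenProj_eq_zero_of_isEdgeProduct hk
      (PfaffianCogates.isEdgeProduct_of_mem_zariskiClosure hT)
      (PfaffianCogates.fourTermRelations_of_mem_cogateCone hcone))
  · refine Set.eq_empty_iff_forall_notMem.2 ?_
    rintro _ ⟨⟨T, hT, rfl⟩, hmul⟩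
    refine PfaffianCogates.cogateMultiple_ne_zero hmul
      (PfaffianCogates.evenProj_eq_zero_of_isEdgeProduct hk
        (PfaffianCogates.isEdgeProduct_of_mem_orbitGL hT) ?_)
    obtain ⟨c, -, P, hP, h⟩ := hmul
    rw [h]
    exact PfaffianCogates.fourTermRelations_smul_cogate hP c
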